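/- Let $f:\mathbb{R}^d\times\mathcal{Z}\to[0,1]$ be a loss, measurable in $z$, let $\mathcal{D}$ be a probability distribution on $\mathcal{Z}$, and let $R(w)=\mathbb{E}_{z\sim\mathcal{D}}[f(w,z)]$, $R^\star=\inf_w R(w)$. Let $S=(z_1,\dots,z_m)\sim\mathcal{D}^m$. SGD started at $w_1$ performs the updates $w_{S,t+1}=w_{S,t}-\alpha_t\nabla f(w_{S,t},z_{j_t})$, $t=1,\dots,T$, with $1\le T\le m$, where $w_{S,1}=w_1$ and $j_1,\dots,j_T$ are drawn uniformly without replacement from $\{1,\dots,m\}$, independently of $S$; $A_S$ denotes the point reached after the $T$ updates, and $\mathbb{E}_A$ the expectation over the indices. SGD is called $\epsilon$-on-average stable if $$\sup_{i\in\{1,\dots,m\}}\ \mathbb{E}_{S,z}\,\mathbb{E}_A\big[f(A_S,z)-f(A_{S^{(i)}},z)\big]\le\epsilon ,$$ where $z\sim\mathcal{D}$ is independent of $S$, and $S^{(i)}$ is $S$ with its $i$-th example replaced by $z$. Assume that for every $z$ the function $f(\cdot,z)$ is twice differentiable, with $\|\nabla f(w,z)\|\le L$, $\|\nabla f(w,z)-\nabla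 f(v,z)\|\le\beta\|w-v\|$ and $\|\nabla^2 f(w,z)-\nabla^2 f(v,z)\|_2\le\rho\|w-v\|$ for all $w,v$ (with $\beta>0$, $\rho\ge 0$); that $\mathbb{E}_{S,z}\mathbb{E}_A\|\nabla f(w_{S,t},z)-\nabla R(w_{S,t})\|^2\le\sigma^2$ for $t=1,\dots,T$ (with $\sigma\ge 0$); that $\alpha_t=c/t$ with $c>0$, $c\le 1/\beta$ and $4c\,(2\beta\ln T)^2\le 1$; and that $\mathbb{E}_{S}\mathbb{E}_A[R(A_S)]\le R(w_1)$. (1) Let $\gamma>0$ be of order $\tilde{\mathcal{O}}\big(\min\{\beta,\ \mathbb{E}_z\|\nabla^2 f(w_1,z)\|_2+\rho\,(c\sigma+\sqrt{c\,(R(w_1)-R^\star)})\}\big)$, that is, $\gamma\le\kappa\,(1+\ln T)^k\min\{\dots\}$ with constants $\kappa\in\mathbb{R}$ and $k\in\mathbb{N}$. Then SGD is $\epsilon$-on-average stable with $$\epsilon= C\cdot\frac{1+\frac{1}{c\gamma}}{m}\,\big(R(w_1)\,T\big)^{\frac{c\gamma}{1+c\gamma}},$$ where $C$ depends only on $L$,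 $\beta$, $\kappa$ and $k$. (2) The stability vanishes as the risk at the initialization point goes to zero: for every $\eta>0$ there is a $\delta>0$, depending on $\eta$ only, such that SGD is $\eta$-on-average stable whenever the above assumptions hold and $R(w_1)\le\delta$. -/

import Mathlib

open MeasureTheory

universe u

noncomputable section

namespace SGDStability

/-- The parameter space `ℝ^d` with its Euclidean norm. -/
abbrev Param (d : ℕ) : Type := EuclideanSpace ℝ (Fin d)

/-- The gradient `∇f(w, z)` of the loss in the parameter. -/
def lossGrad {d : ℕ} {Z : Type u} (f : Param d → Z → ℝ) (w : Param d) (z : Z) : Param d :=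
  gradient (fun v => f v z) w

/-- The Hessian `∇²f(w, z)` of the loss in the parameter, as a continuous linear map: the
derivative of the gradient. Its operator norm is the spectral norm. -/
def lossHess {d : ℕ} {Z : Type u} (f : Param d → Z → ℝ) (w : Param d) (z : Z) :
    Param d →L[ℝ] Param d :=
  fderiv ℝ (fun v => lossGrad f v z) w

/-- The risk `R(w) = E_z[f(w, z)]`. -/
def risk {d : ℕ} {Z : Type u} [MeasurableSpace Z] (f : Param d → Z → ℝ) (D : Measure Z)
    (w : Param d) : ℝ :=
  ∫ z, f w z ∂D

/-- The minimal risk `R⋆ = inf_w R(w)`. -/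
def minRisk {d : ℕ} {Z : Type u} [MeasurableSpace Z] (f : Param d → Z → ℝ) (D : Measure Z) : ℝ :=
  ⨅ w, risk f D w

/-- `f` is `L`-Lipschitz: it is differentiable in the parameter, with gradients bounded by `L`. -/
def IsLipschitzLoss {d : ℕ} {Z : Type u} (f : Param d → Z → ℝ) (L : ℝ) : Prop :=
  ∀ z, Differentiable ℝ (fun w => f w z) ∧ ∀ w, ‖lossGrad f w z‖ ≤ L

/-- `f` is `β`-smooth: it is differentiable in the parameter, with `β`-Lipschitz gradients. -/
def IsSmoothLoss {d : ℕ} {Z : Type u} (f : Param d → Z → ℝ) (β : ℝ) : Prop :=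
  ∀ z, Differentiable ℝ (fun w => f w z) ∧
    ∀ w v, ‖lossGrad f w z - lossGrad f v z‖ ≤ β * ‖w - v‖

/-- `f` has a `ρ`-Lipschitz Hessian: it is twice differentiable in the parameter, and its Hessian
is `ρ`-Lipschitz in the spectral norm. -/
def HasLipschitzHessian {d : ℕ} {Z : Type u} (f : Param d → Z → ℝ) (ρ : ℝ) : Prop :=
  ∀ z, Differentiable ℝ (fun w => f w z) ∧ Differentiable ℝ (fun w => lossGrad f w z) ∧
    ∀ w v, ‖lossHess f w z - lossHess f v z‖ ≤ ρ * ‖w - v‖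

/-- The SGD iterate after `t` updates, started at `w₁`, on the training set `S`, with the indices
`J 0, …, J (T - 1)` and the step sizes `c / 1, c / 2, …, c / T`. In the one-based numbering
`w_{S,1} = w₁`, `w_{S,t+1} = w_{S,t} - (c / t) ∇f(w_{S,t}, z_{j_t})`, this is `w_{S,t+1}`.
After `T` updates the sequence is constant. -/
def sgdIter {d : ℕ} {Z : Type u} (f : Param d → Z → ℝ) (c : ℝ) (w₁ : Param d) {m T : ℕ}
    (J : Fin T ↪ Fin m) (S : Fin m → Z) : ℕ → Param d
  | 0 => w₁
  | t + 1 =>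
    if h : t < T then
      sgdIter f c w₁ J S t - (c / ((t : ℝ) + 1)) • lossGrad f (sgdIter f c w₁ J S t) (S (J ⟨t, h⟩))
    else sgdIter f c w₁ J S t

/-- The output `A_S` of SGD: the point reached after all `T` updates. -/
def sgdOutput {d : ℕ} {Z : Type u} (f : Param d → Z → ℝ) (c : ℝ) (w₁ : Param d) {m T : ℕ}
    (J : Fin T ↪ Fin m) (S : Fin m → Z) : Param d :=
  sgdIter f c w₁ J S T

/-- The expectation `E_A` over `T` indices drawn from `{1, …, m}` uniformly without replacement,
that is, over a uniformly distributed injection. -/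
def expectIdx {m T : ℕ} (g : (Fin T ↪ Fin m) → ℝ) : ℝ :=
  (∑ J : Fin T ↪ Fin m, g J) / (Fintype.card (Fin T ↪ Fin m) : ℝ)

/-- The law of `(S, z)`, where `S` consists of `m` independent examples with law `D`, and `z` is
one more independent example. -/
def sampleLaw {Z : Type u} [MeasurableSpace Z] (D : Measure Z) (m : ℕ) :
    Measure ((Fin m → Z) × Z) :=
  (Measure.pi fun _ : Fin m => D).prod D

/-- SGD with `T` steps on `m` examples is `ε`-on-average stable for `D` and `w₁`:
`sup_i E_{S,z} E_A [f(A_S, z) - f(A_{S^(i)}, z)] ≤ ε`, where `S^(i)` is `S` with its `i`-th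
example replaced by `z`. -/
def SGDOnAverageStable {d : ℕ} {Z : Type u} [MeasurableSpace Z] (f : Param d → Z → ℝ)
    (D : Measure Z) (c : ℝ) (w₁ : Param d) (m T : ℕ) (ε : ℝ) : Prop :=
  ∀ i : Fin m,
    ∫ p, expectIdx (fun J : Fin T ↪ Fin m =>
        f (sgdOutput f c w₁ J p.1) p.2 - f (sgdOutput f c w₁ J (Function.update p.1 i p.2)) p.2)
      ∂(sampleLaw D m) ≤ ε

/-- The variance of the stochastic gradients is at most `σ²` at each of the points
`w_{S,1}, …, w_{S,T}` at which SGD takes a step. -/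
def GradVarianceLE {d : ℕ} {Z : Type u} [MeasurableSpace Z] (f : Param d → Z → ℝ)
    (D : Measure Z) (c : ℝ) (w₁ : Param d) (m T : ℕ) (σ : ℝ) : Prop :=
  ∀ t < T,
    ∫ p, expectIdx (fun J : Fin T ↪ Fin m =>
        ‖lossGrad f (sgdIter f c w₁ J p.1 t) p.2
          - gradient (risk f D) (sgdIter f c w₁ J p.1 t)‖ ^ 2)
      ∂(sampleLaw D m) ≤ σ ^ 2

/-- The expected risk `E_{S,A}[R(A_S)]` of the output of SGD. -/
def expectedOutputRisk {d : ℕ} {Z : Type u} [MeasurableSpace Z] (f : Param d → Z → ℝ)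
    (D : Measure Z) (c : ℝ) (w₁ : Param d) (m T : ℕ) : ℝ :=
  ∫ S, expectIdx (fun J : Fin T ↪ Fin m => risk f D (sgdOutput f c w₁ J S))
    ∂(Measure.pi fun _ : Fin m => D)

/-- The quantity `min {β, E_z ‖∇²f(w₁, z)‖₂ + Δ⋆}` with `Δ⋆ = ρ (c σ + √(c (R(w₁) - R⋆)))`. -/
def curvatureScale {d : ℕ} {Z : Type u} [MeasurableSpace Z] (f : Param d → Z → ℝ)
    (D : Measure Z) (β ρ σ c : ℝ) (w₁ : Param d) : ℝ :=
  min β ((∫ z, ‖lossHess f w₁ z‖ ∂D)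
    + ρ * (c * σ + Real.sqrt (c * (risk f D w₁ - minRisk f D))))

/-- The conditions on the loss, the step sizes, the sample size and the number of steps. The two
upper bounds on `c` say `c ≤ 1 / β` and `c ≤ 1 / (4 (2 β ln T)²)`; the latter is no restriction
when `T = 1`. -/
structure NonconvexSGDConditions {d : ℕ} {Z : Type u} [MeasurableSpace Z] (f : Param d → Z → ℝ)
    (D : Measure Z) (L β ρ σ c : ℝ) (w₁ : Param d) (m T : ℕ) : Prop where
  meas : ∀ w, Measurable (f w)
  mem_Icc : ∀ w z, f w z ∈ Set.Icc (0 : ℝ) 1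
  lipschitz : IsLipschitzLoss f L
  smooth : IsSmoothLoss f β
  hessian : HasLipschitzHessian f ρ
  beta_pos : 0 < β
  rho_nonneg : 0 ≤ ρ
  sigma_nonneg : 0 ≤ σ
  one_le_T : 1 ≤ T
  T_le_m : T ≤ m
  c_pos : 0 < c
  c_le : c * β ≤ 1
  c_le_log : c * (4 * (2 * β * Real.log T) ^ 2) ≤ 1
  variance : GradVarianceLE f D c w₁ m T σ

end SGDStability

end

/-!
The stability bound follows from two elementary estimates of the on-average stability of SGD, each
proportional to the probability that the replaced example is used at a given step, which is `1 / m`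
(`expectIdx_indicator`).

* *Through the risk.* If SGD never visits the replaced example, both runs produce the same output.
  Otherwise drop the subtracted loss. Because the examples are exchangeable, the expected risk of
  the output is the same for every choice of indices (`integral_risk_sgdOutput_eq`), so it is
  independent of the event that the example is visited, which has probability `T / m`. As SGD does
  not increase the expected risk, it is `R(w₁) T / m`-stable (`stable_risk_mul_steps_div`), and
  likewise `R(w₁)`-stable (`stable_risk`).
* *Through the growth of perturbations.* The replaced example moves the iterate by at most
  `2 c L / t` at the step that uses it, and every later step expands distances by a factor of at
  most `1 + c β / t`, hence all of them by at most `exp (c β H_T)`, with `H_T` the harmonic number.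
  The conditions `c β ≤ 1` and `4 c (2 β log T) ^ 2 ≤ 1` bound both `c H_T` and this factor in
  terms of `β` alone for `T ≥ 2` (`mul_harmonic_le_stepBudget`), so SGD is
  `C / m`-stable with `C` depending only on `L` and `β` (`stable_const_div`).

With `a = R(w₁) T` and `y = c γ / (1 + c γ) ∈ (0, 1)`, the right-hand side of the claim is
`C a ^ y / (y m)`. It dominates `a / m` if `a ≤ 1`, because then `a ≤ a ^ y`; and it dominates
`C / m` if `a ≥ 1`, because then `a ^ y ≥ 1`. This argument is uniform in `γ > 0`. The second claim
is the `R(w₁)`-stability, with `δ = η`.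
-/

namespace SGDStability

/-! ### Regularity of the loss -/

section Regularity

variable {d : ℕ} {Z : Type u} {f : Param d → Z → ℝ} {L β : ℝ}

lemma IsLipschitzLoss.abs_sub_le (h : IsLipschitzLoss f L) (w v : Param d) (z : Z) :
    |f w z - f v z| ≤ L * ‖w - v‖ := by
  have key := Convex.norm_image_sub_le_of_norm_fderiv_le (𝕜 := ℝ) (f := fun w => f w z) (C := L)
    (s := Set.univ) (x := v) (y := w) (fun x _ => (h z).1 x) (fun x _ => ?_) convex_univ
    (Set.mem_univ _) (Set.mem_univ _)
  · simpa using key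
  · rw [← toDual_gradient, LinearIsometryEquiv.norm_map]
    exact (h z).2 x

lemma IsSmoothLoss.continuous (h : IsSmoothLoss f β) (z : Z) : Continuous fun w => f w z :=
  (h z).1.continuous

lemma IsSmoothLoss.continuous_lossGrad (h : IsSmoothLoss f β) (z : Z) :
    Continuous fun w => lossGrad f w z :=
  (LipschitzWith.of_dist_le' (K := β) fun w v => by
    simpa [dist_eq_norm] using (h z).2 w v).continuous

variable [MeasurableSpace Z]

lemma IsSmoothLoss.measurable_uncurry (h : IsSmoothLoss f β) (hf : ∀ w, Measurable (f w)) :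
    Measurable (Function.uncurry f) :=
  measurable_uncurry_of_continuous_of_measurable h.continuous hf

/-- The gradient is measurable in the example, since its coordinates are limits of difference
quotients. -/
lemma IsSmoothLoss.measurable_lossGrad (h : IsSmoothLoss f β) (hf : ∀ w, Measurable (f w))
    (w : Param d) : Measurable (lossGrad f w) := by
  let b := EuclideanSpace.basisFun (Fin d) ℝ
  have hdir (i : Fin d) : Measurable fun z => fderiv ℝ (fun v => f v z) w (b i) := by
    refine measurable_of_tendsto_metrizable
      (f := fun (n : ℕ) z => (n : ℝ) • (f (w + (n : ℝ)⁻¹ • b i) z - f w z)) (fun n => ?_) ?_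
    · exact ((hf _).sub (hf _)).const_smul (n : ℝ)
    · refine tendsto_pi_nhds.2 fun z => ?_
      exact ((((h z).1 w).hasFDerivAt).lim_real (b i)).comp tendsto_natCast_atTop_atTop
  have hsum : lossGrad f w = fun z => ∑ i, fderiv ℝ (fun v => f v z) w (b i) • b i := by
    funext z
    rw [← b.sum_repr' (lossGrad f w z)]
    refine Finset.sum_congr rfl fun i _ => ?_
    rw [real_inner_comm, lossGrad, inner_gradient_left]
  rw [hsum]
  exact Finset.measurable_sum _ fun i _ => (hdir i).smul_const (b i)

lemma IsSmoothLoss.measurable_uncurry_lossGrad (h : IsSmoothLoss f β)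
    (hf : ∀ w, Measurable (f w)) : Measurable (Function.uncurry (lossGrad f)) :=
  measurable_uncurry_of_continuous_of_measurable h.continuous_lossGrad (h.measurable_lossGrad hf)

lemma IsSmoothLoss.measurable_sgdIter (h : IsSmoothLoss f β) (hf : ∀ w, Measurable (f w))
    (c : ℝ) (w₁ : Param d) {m T : ℕ} (J : Fin T ↪ Fin m) (t : ℕ) :
    Measurable fun S => sgdIter f c w₁ J S t := by
  induction t with
  | zero => simp only [sgdIter]; exact measurable_const
  | succ t ih =>
    simp only [sgdIter]
    split_ifs with ht
    · exact ih.sub (((h.measurable_uncurry_lossGrad hf).comp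
        (ih.prodMk (measurable_pi_apply (J ⟨t, ht⟩)))).const_smul (c / ((t : ℝ) + 1)))
    · exact ih

end Regularity

/-! ### Uniformly random injections -/

section ExpectIdx

variable {m T : ℕ}

lemma card_embedding_pos (hTm : T ≤ m) : (0 : ℝ) < Fintype.card (Fin T ↪ Fin m) := by
  have : Nonempty (Fin T ↪ Fin m) := ⟨Fin.castLEEmb hTm⟩
  exact_mod_cast Fintype.card_pos

lemma expectIdx_mono {g h : (Fin T ↪ Fin m) → ℝ} (hgh : ∀ J, g J ≤ h J) :
    expectIdx g ≤ expectIdx h :=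
  div_le_div_of_nonneg_right (Finset.sum_le_sum fun J _ => hgh J) (Nat.cast_nonneg _)

lemma expectIdx_const (hTm : T ≤ m) (x : ℝ) : expectIdx (fun _ : Fin T ↪ Fin m => x) = x := by
  have := card_embedding_pos hTm
  simp only [expectIdx, Finset.sum_const, Finset.card_univ, nsmul_eq_mul]
  field_simp

lemma expectIdx_mul_const (g : (Fin T ↪ Fin m) → ℝ) (x : ℝ) :
    expectIdx (fun J => g J * x) = expectIdx g * x := by
  simp only [expectIdx, ← Finset.sum_mul]
  ring

lemma expectIdx_sum {ι : Type*} (s : Finset ι) (g : ι → (Fin T ↪ Fin m) → ℝ) :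
    expectIdx (fun J => ∑ i ∈ s, g i J) = ∑ i ∈ s, expectIdx (g i) := by
  simp only [expectIdx, ← Finset.sum_div]
  rw [Finset.sum_comm]

/-- The step `t` visits the example `i` with probability `1 / m`. -/
lemma expectIdx_indicator (hTm : T ≤ m) (t : Fin T) (i : Fin m) :
    expectIdx (fun J : Fin T ↪ Fin m => if J t = i then (1 : ℝ) else 0) = 1 / m := by
  -- By symmetry the probability does not depend on `i`, and the `m` probabilities add up to `1`.
  have hsymm (j : Fin m) :
      expectIdx (fun J : Fin T ↪ Fin m => if J t = j then (1 : ℝ) else 0)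
        = expectIdx (fun J : Fin T ↪ Fin m => if J t = i then (1 : ℝ) else 0) := by
    unfold expectIdx
    congr 1
    refine Fintype.sum_equiv (Equiv.embeddingCongr (Equiv.refl _) (Equiv.swap i j)) _ _ fun J => ?_
    have : (Equiv.swap i j (J t) = i) ↔ J t = j := by
      rw [Equiv.swap_apply_eq_iff, Equiv.swap_apply_left]
    simp [Equiv.embeddingCongr, this]
  have htotal := expectIdx_sum (T := T) Finset.univ
    fun (j : Fin m) (J : Fin T ↪ Fin m) => if J t = j then (1 : ℝ) else 0
  have hm : (m : ℝ) ≠ 0 := by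
    have := i.pos
    positivity
  simp only [Finset.sum_ite_eq, Finset.mem_univ, if_true, expectIdx_const hTm, hsymm,
    Finset.sum_const, Finset.card_univ, Fintype.card_fin, nsmul_eq_mul] at htotal
  field_simp
  linarith

end ExpectIdx

/-! ### Exchangeability and the bounds through the risk -/

section Exchangeability

variable {d : ℕ} {Z : Type u} {f : Param d → Z → ℝ} {c : ℝ} {w₁ : Param d} {m T : ℕ}

/-- Relabelling the indices amounts to permuting the examples. -/
lemma sgdIter_trans_perm (J : Fin T ↪ Fin m) (π : Equiv.Perm (Fin m)) (S : Fin m → Z) (t : ℕ) :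
    sgdIter f c w₁ (J.trans π.toEmbedding) S t = sgdIter f c w₁ J (S ∘ π) t := by
  induction t with
  | zero => rfl
  | succ t ih => simp [sgdIter, ih]

/-- The run is unaffected by the replacement of an example that it does not visit. -/
lemma sgdIter_update_of_forall_ne {J : Fin T ↪ Fin m} {i : Fin m} (hi : ∀ t, J t ≠ i)
    (S : Fin m → Z) (z : Z) (t : ℕ) :
    sgdIter f c w₁ J (Function.update S i z) t = sgdIter f c w₁ J S t := by
  induction t with
  | zero => rfl
  | succ t ih => simp [sgdIter, ih, Function.update_of_ne (hi _)]

/-- The number of steps that visit the example `i`, which is `0` or `1`. -/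
noncomputable def visits (J : Fin T ↪ Fin m) (i : Fin m) : ℝ := ∑ t, if J t = i then (1 : ℝ) else 0

lemma visits_nonneg (J : Fin T ↪ Fin m) (i : Fin m) : 0 ≤ visits J i :=
  Finset.sum_nonneg fun t _ => by split_ifs <;> norm_num

lemma expectIdx_visits (hTm : T ≤ m) (i : Fin m) :
    expectIdx (fun J : Fin T ↪ Fin m => visits J i) = T / m := by
  simp only [visits, expectIdx_sum, expectIdx_indicator hTm, Finset.sum_const, Finset.card_univ,
    Fintype.card_fin, nsmul_eq_mul]
  ring

lemma loss_sub_le_visits_mul (hf : ∀ w z, f w z ∈ Set.Icc (0 : ℝ) 1) (J : Fin T ↪ Fin m)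
    (i : Fin m) (S : Fin m → Z) (z : Z) :
    f (sgdOutput f c w₁ J S) z - f (sgdOutput f c w₁ J (Function.update S i z)) z
      ≤ visits J i * f (sgdOutput f c w₁ J S) z := by
  by_cases h : ∃ t, J t = i
  · obtain ⟨s, rfl⟩ := h
    have h1 : visits J (J s) = 1 := by simp [visits]
    rw [h1, one_mul]
    linarith [(hf (sgdOutput f c w₁ J (Function.update S (J s) z)) z).1]
  · push Not at h
    rw [sgdOutput, sgdOutput, sgdIter_update_of_forall_ne h, sub_self]
    exact mul_nonneg (visits_nonneg J i) (hf _ _).1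

variable [MeasurableSpace Z] {D : Measure Z}

lemma risk_nonneg (hf : ∀ w z, f w z ∈ Set.Icc (0 : ℝ) 1) (w : Param d) : 0 ≤ risk f D w :=
  integral_nonneg fun z => (hf w z).1

variable [IsProbabilityMeasure D] {β : ℝ}

instance : IsProbabilityMeasure (sampleLaw D m) := by
  unfold sampleLaw
  infer_instance

/-- The expected risk of the output is the same for every choice of the indices. -/
lemma integral_risk_sgdOutput_eq (J J' : Fin T ↪ Fin m) :
    ∫ S, risk f D (sgdOutput f c w₁ J S) ∂(Measure.pi fun _ : Fin m => D)
      = ∫ S, risk f D (sgdOutput f c w₁ J' S) ∂(Measure.pi fun _ : Fin m => D) := by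
  have := Equiv.Perm.isMultiplyPretransitive (Fin m) T
  obtain ⟨π, hπ⟩ := MulAction.exists_smul_eq (Equiv.Perm (Fin m)) J J'
  have hJ' : J' = J.trans π.toEmbedding := by
    rw [← hπ]
    rfl
  have hmp := measurePreserving_piCongrLeft (fun _ : Fin m => D) π.symm
  have key := hmp.integral_comp' fun S => risk f D (sgdOutput f c w₁ J S)
  rw [← key, hJ']
  refine integral_congr_ae (Filter.Eventually.of_forall fun S => ?_)
  simp only [sgdOutput, sgdIter_trans_perm]
  congr 2
  funext j
  have := MeasurableEquiv.piCongrLeft_apply_apply (β := fun _ : Fin m => Z) π.symm S (π j)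
  simp only [Equiv.symm_apply_apply] at this
  exact this

lemma integrable_loss_sgdOutput (hs : IsSmoothLoss f β) (hmeas : ∀ w, Measurable (f w))
    (hf : ∀ w z, f w z ∈ Set.Icc (0 : ℝ) 1) (J : Fin T ↪ Fin m) :
    Integrable (fun p : (Fin m → Z) × Z => f (sgdOutput f c w₁ J p.1) p.2) (sampleLaw D m) := by
  have hm : Measurable fun p : (Fin m → Z) × Z => f (sgdOutput f c w₁ J p.1) p.2 :=
    (hs.measurable_uncurry hmeas).comp
      (((hs.measurable_sgdIter hmeas c w₁ J T).comp measurable_fst).prodMk measurable_snd)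
  refine Integrable.of_bound hm.aestronglyMeasurable 1 (Filter.Eventually.of_forall fun p => ?_)
  rw [Real.norm_of_nonneg (hf _ _).1]
  exact (hf _ _).2

lemma integral_loss_sgdOutput (hs : IsSmoothLoss f β) (hmeas : ∀ w, Measurable (f w))
    (hf : ∀ w z, f w z ∈ Set.Icc (0 : ℝ) 1) (J : Fin T ↪ Fin m) :
    ∫ p, f (sgdOutput f c w₁ J p.1) p.2 ∂(sampleLaw D m)
      = ∫ S, risk f D (sgdOutput f c w₁ J S) ∂(Measure.pi fun _ : Fin m => D) := by
  have h := integrable_loss_sgdOutput (D := D) (c := c) (w₁ := w₁) hs hmeas hf J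
  unfold sampleLaw at h ⊢
  rw [integral_prod _ h]
  rfl

lemma expectedOutputRisk_eq (hs : IsSmoothLoss f β) (hmeas : ∀ w, Measurable (f w))
    (hf : ∀ w z, f w z ∈ Set.Icc (0 : ℝ) 1) (hTm : T ≤ m) (J : Fin T ↪ Fin m) :
    expectedOutputRisk f D c w₁ m T
      = ∫ S, risk f D (sgdOutput f c w₁ J S) ∂(Measure.pi fun _ : Fin m => D) := by
  have hint (J' : Fin T ↪ Fin m) : Integrable (fun S => risk f D (sgdOutput f c w₁ J' S))
      (Measure.pi fun _ : Fin m => D) :=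
    Integrable.integral_prod_left (integrable_loss_sgdOutput hs hmeas hf J')
  unfold expectedOutputRisk expectIdx
  rw [integral_div, integral_finsetSum _ fun J' _ => hint J',
    Finset.sum_congr rfl fun J' _ => integral_risk_sgdOutput_eq J' J]
  exact expectIdx_const hTm _

/-- Replacing an example raises the expected loss by at most the probability of visiting it times
the expected risk of the output: the two are independent by exchangeability. -/
lemma integral_loss_sub_le (hs : IsSmoothLoss f β) (hmeas : ∀ w, Measurable (f w))
    (hf : ∀ w z, f w z ∈ Set.Icc (0 : ℝ) 1) (hTm : T ≤ m) (i : Fin m) :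
    ∫ p, expectIdx (fun J : Fin T ↪ Fin m =>
        f (sgdOutput f c w₁ J p.1) p.2 - f (sgdOutput f c w₁ J (Function.update p.1 i p.2)) p.2)
      ∂(sampleLaw D m) ≤ T / m * expectedOutputRisk f D c w₁ m T := by
  have hint (J : Fin T ↪ Fin m) : Integrable (fun p : (Fin m → Z) × Z =>
      visits J i * f (sgdOutput f c w₁ J p.1) p.2) (sampleLaw D m) :=
    (integrable_loss_sgdOutput hs hmeas hf J).const_mul _
  have hright : ∫ p, expectIdx (fun J : Fin T ↪ Fin m =>
      visits J i * f (sgdOutput f c w₁ J p.1) p.2) ∂(sampleLaw D m)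
        = T / m * expectedOutputRisk f D c w₁ m T := by
    rw [← expectIdx_visits hTm i, ← expectIdx_mul_const]
    unfold expectIdx
    rw [integral_div, integral_finsetSum _ fun J _ => hint J]
    congr 1
    refine Finset.sum_congr rfl fun J _ => ?_
    rw [integral_const_mul, integral_loss_sgdOutput hs hmeas hf,
      expectedOutputRisk_eq hs hmeas hf hTm J]
  have hle (p : (Fin m → Z) × Z) := expectIdx_mono fun J : Fin T ↪ Fin m =>
    loss_sub_le_visits_mul (c := c) (w₁ := w₁) hf J i p.1 p.2
  rw [← hright]
  by_cases hleft : Integrable (fun p : (Fin m → Z) × Z => expectIdx (fun J : Fin T ↪ Fin m =>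
      f (sgdOutput f c w₁ J p.1) p.2 - f (sgdOutput f c w₁ J (Function.update p.1 i p.2)) p.2))
      (sampleLaw D m)
  · exact integral_mono hleft ((integrable_finsetSum _ fun J _ => hint J).div_const _) hle
  · rw [integral_undef hleft]
    refine integral_nonneg fun p => ?_
    exact div_nonneg (Finset.sum_nonneg fun J _ => mul_nonneg (visits_nonneg J i) (hf _ _).1)
      (Nat.cast_nonneg _)

lemma risk_le_one (hf : ∀ w z, f w z ∈ Set.Icc (0 : ℝ) 1) (w : Param d) : risk f D w ≤ 1 := by
  have h := norm_integral_le_of_norm_le_const (μ := D) (f := f w) (C := 1)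
    (Filter.Eventually.of_forall fun z => by
      rw [Real.norm_of_nonneg (hf w z).1]
      exact (hf w z).2)
  simpa [risk] using (le_abs_self _).trans h

variable {L ρ σ : ℝ}

lemma stable_risk_mul_steps_div (h : NonconvexSGDConditions f D L β ρ σ c w₁ m T)
    (hR : expectedOutputRisk f D c w₁ m T ≤ risk f D w₁) :
    SGDOnAverageStable f D c w₁ m T (risk f D w₁ * T / m) := fun i =>
  (integral_loss_sub_le h.smooth h.meas h.mem_Icc h.T_le_m i).trans <| by
    rw [mul_div_assoc, mul_comm (risk f D w₁)]
    exact mul_le_mul_of_nonneg_left hR (by positivity)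

lemma stable_risk (h : NonconvexSGDConditions f D L β ρ σ c w₁ m T)
    (hR : expectedOutputRisk f D c w₁ m T ≤ risk f D w₁) :
    SGDOnAverageStable f D c w₁ m T (risk f D w₁) := fun i => by
  refine (stable_risk_mul_steps_div h hR i).trans ?_
  have hm : (0 : ℝ) < m := by exact_mod_cast i.pos
  rw [mul_div_assoc]
  refine mul_le_of_le_one_right (risk_nonneg h.mem_Icc w₁) ?_
  rw [div_le_one hm]
  exact_mod_cast h.T_le_m

end Exchangeability

/-! ### Growth of perturbations -/

section Growth

variable {d : ℕ} {Z : Type u} {f : Param d → Z → ℝ} {c L β : ℝ} {w₁ : Param d} {m T : ℕ}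

/-- The displacement caused by the replacement of the example `i` at step `t`: it vanishes unless
that step uses the example. -/
noncomputable def kick (c L : ℝ) (J : Fin T ↪ Fin m) (i : Fin m) (t : ℕ) : ℝ :=
  if h : t < T then (if J ⟨t, h⟩ = i then 1 else 0) * (2 * L * (c / ((t : ℝ) + 1))) else 0

lemma kick_nonneg (hc : 0 ≤ c) (hL : 0 ≤ L) (J : Fin T ↪ Fin m) (i : Fin m) (t : ℕ) :
    0 ≤ kick c L J i t := by
  unfold kick
  split_ifs <;> positivity

/-- One update expands distances by at most `1 + c β / (t + 1)`, up to the displacement caused by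
the replaced example. -/
lemma norm_sgdIter_succ_sub_le (hc : 0 ≤ c) (hβ : 0 ≤ β) (hl : IsLipschitzLoss f L)
    (hs : IsSmoothLoss f β) (J : Fin T ↪ Fin m) (i : Fin m) (S : Fin m → Z) (z : Z) (t : ℕ) :
    ‖sgdIter f c w₁ J S (t + 1) - sgdIter f c w₁ J (Function.update S i z) (t + 1)‖
      ≤ (1 + c * β / ((t : ℝ) + 1))
          * ‖sgdIter f c w₁ J S t - sgdIter f c w₁ J (Function.update S i z) t‖
        + kick c L J i t := by
  simp only [sgdIter, kick]
  set w := sgdIter f c w₁ J S t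
  set v := sgdIter f c w₁ J (Function.update S i z) t
  have hpos : 0 ≤ c / ((t : ℝ) + 1) := by positivity
  have hgrow : (1 + c * β / ((t : ℝ) + 1)) * ‖w - v‖
      = ‖w - v‖ + c / ((t : ℝ) + 1) * (β * ‖w - v‖) := by ring
  by_cases ht : t < T
  · simp only [ht, dif_pos]
    have hstep (x y : Param d) :
        ‖w - (c / ((t : ℝ) + 1)) • x - (v - (c / ((t : ℝ) + 1)) • y)‖
          ≤ ‖w - v‖ + c / ((t : ℝ) + 1) * ‖x - y‖ := by
      have : w - (c / ((t : ℝ) + 1)) • x - (v - (c / ((t : ℝ) + 1)) • y)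
          = (w - v) - (c / ((t : ℝ) + 1)) • (x - y) := by
        rw [smul_sub]
        abel
      rw [this]
      refine (norm_sub_le _ _).trans_eq ?_
      rw [norm_smul, Real.norm_of_nonneg hpos]
    refine (hstep _ _).trans ?_
    by_cases hi : J ⟨t, ht⟩ = i
    · -- The two gradients are taken on different examples and are only known to be bounded.
      rw [if_pos hi, one_mul, hgrow]
      have hgrad (a b : Z) : ‖lossGrad f w a - lossGrad f v b‖ ≤ 2 * L :=
        (norm_sub_le _ _).trans (by linarith [(hl a).2 w, (hl b).2 v])
      have h1 := mul_le_mul_of_nonneg_left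
        (hgrad (S (J ⟨t, ht⟩)) (Function.update S i z (J ⟨t, ht⟩))) hpos
      have h2 : 0 ≤ c / ((t : ℝ) + 1) * (β * ‖w - v‖) := by positivity
      linarith
    · rw [if_neg hi, zero_mul, add_zero, hgrow, Function.update_of_ne hi]
      gcongr
      exact (hs _).2 w v
  · simp only [ht, dif_neg, not_false_eq_true, add_zero, hgrow]
    have h2 : 0 ≤ c / ((t : ℝ) + 1) * (β * ‖w - v‖) := by positivity
    linarith

lemma norm_sgdIter_sub_le (hc : 0 ≤ c) (hβ : 0 ≤ β) (hL : 0 ≤ L) (hl : IsLipschitzLoss f L)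
    (hs : IsSmoothLoss f β) (J : Fin T ↪ Fin m) (i : Fin m) (S : Fin m → Z) (z : Z) (n : ℕ) :
    ‖sgdIter f c w₁ J S n - sgdIter f c w₁ J (Function.update S i z) n‖
      ≤ Real.exp (c * β * harmonic n) * ∑ t ∈ Finset.range n, kick c L J i t := by
  induction n with
  | zero => simp [sgdIter]
  | succ n ih =>
    refine (norm_sgdIter_succ_sub_le hc hβ hl hs J i S z n).trans ?_
    have hexp : Real.exp (c * β * harmonic (n + 1))
        = Real.exp (c * β / ((n : ℝ) + 1)) * Real.exp (c * β * harmonic n) := by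
      rw [← Real.exp_add, harmonic_succ]
      push_cast
      congr 1
      ring
    have hge : 1 ≤ Real.exp (c * β * harmonic (n + 1)) := by
      refine Real.one_le_exp (mul_nonneg (mul_nonneg hc hβ) ?_)
      exact_mod_cast (harmonic_pos n.succ_ne_zero).le
    rw [Finset.sum_range_succ, mul_add]
    refine add_le_add ?_ (le_mul_of_one_le_left (kick_nonneg hc hL J i n) hge)
    rw [hexp, mul_assoc]
    refine mul_le_mul ?_ ih (norm_nonneg _) (Real.exp_pos _).le
    linarith [Real.add_one_le_exp (c * β / ((n : ℝ) + 1))]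

lemma expectIdx_sum_kick (hTm : T ≤ m) (c L : ℝ) (i : Fin m) :
    expectIdx (fun J : Fin T ↪ Fin m => ∑ t ∈ Finset.range T, kick c L J i t)
      = 2 * L * (c * harmonic T) / m := by
  have hJ (J : Fin T ↪ Fin m) : ∑ t ∈ Finset.range T, kick c L J i t
      = ∑ t : Fin T, (if J t = i then 1 else 0) * (2 * L * (c / ((t : ℝ) + 1))) := by
    simp [Finset.sum_range, kick]
  simp only [hJ, expectIdx_sum, expectIdx_mul_const, expectIdx_indicator hTm]
  simp only [harmonic, Finset.sum_range]
  push_cast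
  simp only [Finset.mul_sum, Finset.sum_div]
  refine Finset.sum_congr rfl fun t _ => ?_
  ring

/-- A bound on `c H_T` that depends on the smoothness only. -/
noncomputable def stepBudget (β : ℝ) : ℝ := 1 / β + 1 / (16 * β ^ 2 * Real.log 2)

lemma mul_harmonic_le_stepBudget (hβ : 0 < β) (hc : 0 < c) (hcβ : c * β ≤ 1) (hT : 2 ≤ T)
    (hlog : c * (4 * (2 * β * Real.log T) ^ 2) ≤ 1) : c * harmonic T ≤ stepBudget β := by
  have h2 : 0 < Real.log 2 := Real.log_pos (by norm_num)
  have hle : Real.log 2 ≤ Real.log T := Real.log_le_log (by norm_num) (by exact_mod_cast hT)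
  have h1 : c ≤ 1 / β := by rwa [le_div_iff₀ hβ]
  have h3 : c * Real.log T ≤ 1 / (16 * β ^ 2 * Real.log 2) := by
    rw [le_div_iff₀ (by positivity)]
    calc c * Real.log T * (16 * β ^ 2 * Real.log 2)
        ≤ c * Real.log T * (16 * β ^ 2 * Real.log T) := by
          have : 0 ≤ Real.log T := h2.le.trans hle
          gcongr
      _ = c * (4 * (2 * β * Real.log T) ^ 2) := by ring
      _ ≤ 1 := hlog
  have h4 := mul_le_mul_of_nonneg_left (harmonic_le_one_add_log T) hc.le
  unfold stepBudget
  linarith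

variable [MeasurableSpace Z] {D : Measure Z} [IsProbabilityMeasure D] {ρ σ : ℝ}

lemma NonconvexSGDConditions.lipschitz_nonneg
    (h : NonconvexSGDConditions f D L β ρ σ c w₁ m T) : 0 ≤ L := by
  obtain ⟨z⟩ := D.nonempty_of_neZero
  exact (norm_nonneg _).trans ((h.lipschitz z).2 w₁)

lemma stable_const_div (h : NonconvexSGDConditions f D L β ρ σ c w₁ m T) (hT : 2 ≤ T) :
    SGDOnAverageStable f D c w₁ m T
      (2 * L ^ 2 * stepBudget β * Real.exp (β * stepBudget β) / m) := by
  intro i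
  have hL := h.lipschitz_nonneg
  have hβ := h.beta_pos
  have hbudget := mul_harmonic_le_stepBudget hβ h.c_pos h.c_le hT h.c_le_log
  have hdiff (p : (Fin m → Z) × Z) (J : Fin T ↪ Fin m) :
      |f (sgdOutput f c w₁ J p.1) p.2 - f (sgdOutput f c w₁ J (Function.update p.1 i p.2)) p.2|
        ≤ (∑ t ∈ Finset.range T, kick c L J i t) * (L * Real.exp (β * stepBudget β)) := by
    refine (h.lipschitz.abs_sub_le _ _ _).trans ?_
    have h1 := norm_sgdIter_sub_le (w₁ := w₁) h.c_pos.le hβ.le hL h.lipschitz h.smooth J i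
      p.1 p.2 T
    have h2 : Real.exp (c * β * harmonic T) ≤ Real.exp (β * stepBudget β) := by
      rw [Real.exp_le_exp]
      calc c * β * harmonic T = β * (c * harmonic T) := by ring
        _ ≤ β * stepBudget β := by gcongr
    have h3 := Finset.sum_nonneg fun t (_ : t ∈ Finset.range T) =>
      kick_nonneg h.c_pos.le hL J i t
    calc L * ‖sgdOutput f c w₁ J p.1 - sgdOutput f c w₁ J (Function.update p.1 i p.2)‖
        ≤ L * (Real.exp (β * stepBudget β) * ∑ t ∈ Finset.range T, kick c L J i t) :=
          mul_le_mul_of_nonneg_left (h1.trans (mul_le_mul_of_nonneg_right h2 h3)) hL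
      _ = _ := by ring
  have hmean (p : (Fin m → Z) × Z) : ‖expectIdx (fun J : Fin T ↪ Fin m =>
      f (sgdOutput f c w₁ J p.1) p.2 - f (sgdOutput f c w₁ J (Function.update p.1 i p.2)) p.2)‖
        ≤ 2 * L ^ 2 * stepBudget β * Real.exp (β * stepBudget β) / m := by
    have habs : ‖expectIdx (fun J : Fin T ↪ Fin m =>
        f (sgdOutput f c w₁ J p.1) p.2 - f (sgdOutput f c w₁ J (Function.update p.1 i p.2)) p.2)‖
          ≤ expectIdx (fun J : Fin T ↪ Fin m => |f (sgdOutput f c w₁ J p.1) p.2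
              - f (sgdOutput f c w₁ J (Function.update p.1 i p.2)) p.2|) := by
      unfold expectIdx
      rw [norm_div, Real.norm_natCast]
      gcongr
      exact norm_sum_le _ _
    refine habs.trans ((expectIdx_mono (hdiff p)).trans ?_)
    rw [expectIdx_mul_const, expectIdx_sum_kick h.T_le_m]
    calc 2 * L * (c * harmonic T) / m * (L * Real.exp (β * stepBudget β))
        ≤ 2 * L * stepBudget β / m * (L * Real.exp (β * stepBudget β)) := by gcongr
      _ = _ := by ring
  have key := norm_integral_le_of_norm_le_const (μ := sampleLaw D m)
    (Filter.Eventually.of_forall hmean)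
  rw [probReal_univ, mul_one] at key
  exact (le_abs_self _).trans key

end Growth

/-! ### Comparison with the power of the initial risk -/

lemma SGDOnAverageStable.mono {d : ℕ} {Z : Type u} [MeasurableSpace Z] {f : Param d → Z → ℝ}
    {D : Measure Z} {c : ℝ} {w₁ : Param d} {m T : ℕ} {ε ε' : ℝ}
    (h : SGDOnAverageStable f D c w₁ m T ε) (hε : ε ≤ ε') : SGDOnAverageStable f D c w₁ m T ε' :=
  fun i => (h i).trans hε

lemma le_mul_rpow_of_le_one {a x : ℝ} (ha0 : 0 ≤ a) (ha1 : a ≤ 1) (hx : 0 < x) :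
    a ≤ (1 + 1 / x) * a ^ (x / (1 + x)) := by
  have hy : x / (1 + x) ≤ 1 := by
    rw [div_le_one (by positivity)]
    linarith
  have h1 : a ≤ a ^ (x / (1 + x)) := by
    simpa using Real.rpow_le_rpow_of_exponent_ge_of_imp ha0 ha1 hy (by
      intro _ h
      exact absurd h one_ne_zero)
  refine h1.trans (le_mul_of_one_le_left (by positivity) ?_)
  have : 0 < 1 / x := by positivity
  linarith

lemma one_le_mul_rpow_of_one_le {a x : ℝ} (ha : 1 ≤ a) (hx : 0 < x) :
    1 ≤ (1 + 1 / x) * a ^ (x / (1 + x)) := by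
  have h1 : 1 ≤ a ^ (x / (1 + x)) := Real.one_le_rpow ha (by positivity)
  have h2 : 0 < 1 / x := by positivity
  exact one_le_mul_of_one_le_of_one_le (by linarith) h1

end SGDStability

theorem mainTheorem4 :
    (∀ (L β κ : ℝ) (k : ℕ), ∃ C : ℝ, 0 < C ∧
      ∀ (d : ℕ) (Z : Type u) [MeasurableSpace Z] (D : Measure Z) [IsProbabilityMeasure D]
        (f : SGDStability.Param d → Z → ℝ) (ρ σ c : ℝ) (w₁ : SGDStability.Param d) (m T : ℕ),
        SGDStability.NonconvexSGDConditions f D L β ρ σ c w₁ m T →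
        SGDStability.expectedOutputRisk f D c w₁ m T ≤ SGDStability.risk f D w₁ →
        ∀ γ : ℝ, 0 < γ →
          γ ≤ κ * (1 + Real.log T) ^ k * SGDStability.curvatureScale f D β ρ σ c w₁ →
          SGDStability.SGDOnAverageStable f D c w₁ m T
            (C * ((1 + 1 / (c * γ)) / m *
              (SGDStability.risk f D w₁ * T) ^ (c * γ / (1 + c * γ))))) ∧
    (∀ η : ℝ, 0 < η → ∃ δ : ℝ, 0 < δ ∧
      ∀ (d : ℕ) (Z : Type u) [MeasurableSpace Z] (D : Measure Z) [IsProbabilityMeasure D]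
        (f : SGDStability.Param d → Z → ℝ) (L β ρ σ c : ℝ) (w₁ : SGDStability.Param d) (m T : ℕ),
        SGDStability.NonconvexSGDConditions f D L β ρ σ c w₁ m T →
        SGDStability.expectedOutputRisk f D c w₁ m T ≤ SGDStability.risk f D w₁ →
        SGDStability.risk f D w₁ ≤ δ →
        SGDStability.SGDOnAverageStable f D c w₁ m T η) := by
  constructor
  · intro L β κ k
    refine ⟨max 1 (2 * L ^ 2 * SGDStability.stepBudget β
      * Real.exp (β * SGDStability.stepBudget β)), lt_of_lt_of_le one_pos (le_max_left _ _), ?_⟩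
    intro d Z _ D _ f ρ σ c w₁ m T h hR γ hγ _
    have hx : 0 < c * γ := mul_pos h.c_pos hγ
    have hR0 : 0 ≤ SGDStability.risk f D w₁ := SGDStability.risk_nonneg h.mem_Icc w₁
    have ha0 : 0 ≤ SGDStability.risk f D w₁ * T := mul_nonneg hR0 (Nat.cast_nonneg T)
    rw [div_mul_eq_mul_div, ← mul_div_assoc]
    rcases le_or_gt (SGDStability.risk f D w₁ * T) 1 with ha | ha
    · refine (SGDStability.stable_risk_mul_steps_div h hR).mono ?_
      have key := SGDStability.le_mul_rpow_of_le_one ha0 ha hx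
      refine div_le_div_of_nonneg_right ?_ (Nat.cast_nonneg m)
      exact key.trans (le_mul_of_one_le_left (ha0.trans key) (le_max_left _ _))
    · -- As the risk is at most `1`, there are at least two steps.
      have hT : 2 ≤ T := by
        have h1 : SGDStability.risk f D w₁ * T ≤ 1 * T :=
          mul_le_mul_of_nonneg_right (SGDStability.risk_le_one h.mem_Icc w₁) (Nat.cast_nonneg T)
        have h2 : (1 : ℝ) < T := by linarith
        exact_mod_cast h2
      refine (SGDStability.stable_const_div h hT).mono ?_
      have key := SGDStability.one_le_mul_rpow_of_one_le ha.le hx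
      refine div_le_div_of_nonneg_right ?_ (Nat.cast_nonneg m)
      exact (le_max_right _ _).trans
        (le_mul_of_one_le_right (zero_le_one.trans (le_max_left _ _)) key)
  · intro η hη
    refine ⟨η, hη, ?_⟩
    intro d Z _ D _ f L β ρ σ c w₁ m T h hR hδ
    exact (SGDStability.stable_risk h hR).mono hδ
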